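/- Let $G=\mathrm{SL}(2,\mathbb R)$, $K=\mathrm{SO}(2)=\{k_\theta\}$, $a_t=\mathrm{diag}(e^t,e^{-t})$, and let $\|\cdot\|_1$ be the norm of $L^1(G)$ with respect to a Haar measure of $G$. Fix $n\in\mathbb Z$. For $\operatorname{Re}\lambda>0$ and $t>0$ put $$\Phi_\lambda^{n,n}(a_t)=(2\cosh t)^{-(1+\lambda)}\,{}_2F_1\Big(\tfrac{1+\lambda}{2}+\tfrac{|n|}{2},\tfrac{1+\lambda}{2}-\tfrac{|n|}{2};1+\lambda;\cosh^{-2}t\Big),\qquad c^{n,n}(-\lambda)=\frac{2^{1-\lambda}\,\Gamma(\lambda)}{\Gamma\big(\frac{1+\lambda-|n|}{2}\big)\Gamma\big(\frac{1+\lambda+|n|}{2}\big)} .$$ Whenever $c^{n,n}(-\lambda)\neq 0$, let $b_\lambda$ be the function on $G\setminus K$ given by $$b_\lambda(k_\theta a_tk_\psi)=e^{in\theta}\,\frac{\Phi_\lambda^{n,n}(a_t)}{2\lambda\,c^{n,n}(-\lambda)}\,e^{in\psi},\qquad t>0,\ \theta,\psi\in\mathbb R .$$ Let $\mathbf B_1=\bigcup_{i=0}^{\lfloor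 |n|/2\rfloor}B(|n|-2i-1;1)$, where $B(z;1)$ is the open disc of radius $1$ about $z$ in $\mathbb C$. Then: (i) there is a constant $C>0$, independent of $\lambda$, such that for all $\lambda\in\mathbb C$ with $\operatorname{Re}\lambda>1$ and $\lambda\notin\mathbf B_1$ we have $b_\lambda\in L^1(G)$ and $$\|b_\lambda\|_1\le C\,\frac{1+|\lambda|}{\operatorname{Re}\lambda-1};$$ (ii) $\|b_\lambda\|_1\to 0$ as $\lambda\to\infty$ along the positive real axis. -/

import Mathlib

noncomputable section

namespace SL2

/-- The group `G = SL(2, ℝ)`, with the topology it inherits from the `2 × 2` matrices. -/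
abbrev G : Type := Matrix.SpecialLinearGroup (Fin 2) ℝ

/-- The element `k_θ` of `K = SO(2)`. -/
def rot (θ : ℝ) : G :=
  ⟨!![Real.cos θ, Real.sin θ; -Real.sin θ, Real.cos θ], by
    rw [Matrix.det_fin_two_of]; nlinarith [Real.sin_sq_add_cos_sq θ]⟩

/-- The element `a_t = diag(e^t, e^{-t})` of `A`. -/
def dil (t : ℝ) : G :=
  ⟨!![Real.exp t, 0; 0, Real.exp (-t)], by
    rw [Matrix.det_fin_two_of, ← Real.exp_add]; simp⟩

/-- The `c`-function
`c^{n,n}(z) = 2^{1+z} Γ(-z) / (Γ((1-z-|n|)/2) Γ((1-z+|n|)/2))`.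
It is only used at arguments `z = -l` with `0 < Re l`. There `Γ(-z) = Γ(l)` is finite, and since
`Complex.Gamma` is `0` at its poles, the quotient is `0` at a pole of the denominator, as it
should be. -/
def cFun (n : ℤ) (z : ℂ) : ℂ :=
  (2 : ℂ) ^ (1 + z) * Complex.Gamma (-z) /
    (Complex.Gamma ((1 - z - (|n| : ℤ)) / 2) * Complex.Gamma ((1 - z + (|n| : ℤ)) / 2))

/-- The function `Φ^{n,n}_l` on `A⁺`, as a function of `t > 0`:
`(2 cosh t)^{-(1+l)} ₂F₁((1+l)/2 + |n|/2, (1+l)/2 - |n|/2; 1+l; cosh⁻² t)`. -/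
def Phi (n : ℤ) (l : ℂ) (t : ℝ) : ℂ :=
  ((2 * Real.cosh t : ℝ) : ℂ) ^ (-(1 + l)) *
    ordinaryHypergeometric ((1 + l) / 2 + ((|n| : ℤ) : ℂ) / 2) ((1 + l) / 2 - ((|n| : ℤ) : ℂ) / 2)
      (1 + l) (((Real.cosh t ^ 2)⁻¹ : ℝ) : ℂ)

/-- `b_l(a_t) = Φ^{n,n}_l(a_t) / (2 l c^{n,n}(-l))`, for `t > 0`. -/
def bRad (n : ℤ) (l : ℂ) (t : ℝ) : ℂ :=
  1 / (2 * l * cFun n (-l)) * Phi n l t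

/-- For `g = k_θ a_t k_ψ` this is `e^{i(θ+ψ)} cosh t` (see `cart_rot_mul_rot` and `cart_dil`), so
its argument and its modulus are the `K × K`- and the `A`-coordinate of the Cartan
decomposition. -/
def cart (g : G) : ℂ :=
  ⟨(g.1 0 0 + g.1 1 1) / 2, (g.1 0 1 - g.1 1 0) / 2⟩

/-- The function `b_l` on `G`: the extension of `a_t ↦ b_l(a_t)`, `t > 0`, to a function of type
`(n, n)` on `G \ K`; see `bFun_rot_mul_rot` and `bFun_dil`, which determine it there because
`G = K {a_t : t ≥ 0} K`. The values on the null set `K` are irrelevant. -/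
def bFun (n : ℤ) (l : ℂ) (g : G) : ℂ :=
  (cart g / (‖cart g‖ : ℂ)) ^ n * bRad n l (Real.arcosh ‖cart g‖)

/-- The union of the balls `B(|n| - 2i - 1; 1)`, `0 ≤ i ≤ ⌊|n|/2⌋`. -/
def balls (n : ℤ) : Set ℂ :=
  ⋃ i ∈ Finset.range (n.natAbs / 2 + 1), Metric.ball (((|n| - 2 * (i : ℤ) - 1 : ℤ)) : ℂ) 1

theorem cart_rot_mul_rot (θ ψ : ℝ) (g : G) :
    cart (rot θ * g * rot ψ) =
      Complex.exp (θ * Complex.I) * Complex.exp (ψ * Complex.I) * cart g := by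
  rw [Complex.exp_mul_I, Complex.exp_mul_I, ← Complex.ofReal_cos, ← Complex.ofReal_sin,
    ← Complex.ofReal_cos, ← Complex.ofReal_sin]
  have h (i j : Fin 2) : (rot θ * g * rot ψ).1 i j = ((rot θ).1 * g.1 * (rot ψ).1) i j := rfl
  apply Complex.ext <;> simp only [cart, h, Matrix.mul_apply, Fin.sum_univ_two] <;>
    simp [rot, -Complex.ofReal_cos, -Complex.ofReal_sin] <;> ring

theorem cart_dil (t : ℝ) : cart (dil t) = (Real.cosh t : ℂ) := by
  apply Complex.ext
  · rw [Complex.ofReal_re]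
    simp [cart, dil, Real.cosh_eq]
  · simp [cart, dil]

/-- `b_l` is of left and right `K`-type `n`. -/
theorem bFun_rot_mul_rot (n : ℤ) (l : ℂ) (θ ψ : ℝ) (g : G) :
    bFun n l (rot θ * g * rot ψ) =
      Complex.exp (n * θ * Complex.I) * bFun n l g * Complex.exp (n * ψ * Complex.I) := by
  have h (x : ℝ) : Complex.exp (n * x * Complex.I) = Complex.exp (x * Complex.I) ^ n := by
    rw [← Complex.exp_int_mul]; ring_nf
  rw [h, h, bFun, bFun, cart_rot_mul_rot]
  simp only [norm_mul, Complex.norm_exp_ofReal_mul_I, one_mul, mul_div_assoc, mul_zpow]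
  ring

/-- The restriction of `b_l` to `A⁺`. -/
theorem bFun_dil (n : ℤ) (l : ℂ) {t : ℝ} (ht : 0 < t) :
    bFun n l (dil t) = bRad n l t := by
  have h0 : (Real.cosh t : ℂ) ≠ 0 := by exact_mod_cast (Real.cosh_pos t).ne'
  have h1 : ‖(Real.cosh t : ℂ)‖ = Real.cosh t := by
    rw [Complex.norm_real, Real.norm_of_nonneg (Real.cosh_pos t).le]
  rw [bFun, cart_dil, h1, div_self h0, one_zpow, one_mul, Real.arcosh_cosh ht.le]

end SL2

end

namespace SL2

open MeasureTheory Set Filter Topology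
open scoped Nat ENNReal

/-! Put `a = (1+l+|n|)/2`, `b = (1+l-|n|)/2` and `x = cosh⁻² t`. Since `a + b = 1 + l`, the Gamma
factors of the `c`-function combine with the hypergeometric function (`bRad_eq`), and `b_l(a_t)` is
`cosh^{-(1+l)} t / 8` times `Γ(a) Γ(b) / Γ(a+b) · ₂F₁(a, b; a+b; x)`. The singularity of this factor
at `x = 1` is only logarithmic, so it can be bounded by a multiple of `(1-x)^{-1/2}`, uniformly in
`l`.

For `Re b ≥ 1/2` that bound comes from Euler's integral (`exists_norm_betaHG_le_of_re`). Otherwise a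
contiguous relation raises `b` by one at a time, at most `|n|` times (`exists_norm_betaHG_le`). Each
step divides by some `b + i`, and avoiding the balls is what keeps these divisors away from `0`.

In the coordinate `y = cosh² t` the radial part of Haar measure is a multiple of Lebesgue measure on
`(1, ∞)` (`exists_lintegral_comp_norm_cart`). Hence the `L¹` norm is at most a constant times the
integral of `y^{-q} (1 - 1/y)^{-1/2}` with `q = (1 + Re l)/2`. This is `O(1/(q-1) + 1)`, which gives
(i), and it tends to `0` as `q → ∞` by dominated convergence, which gives (ii). -/

/-! ### Hypergeometric identities: power series, contiguous relation, Euler integral. -/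

theorem hasSum_regularizedGaussHGFun (a b c : ℂ) {z : ℂ} (hz : ‖z‖ < 1) :
    HasSum (fun k : ℕ => (ascPochhammer ℂ k).eval a * (ascPochhammer ℂ k).eval b /
      (k ! * Complex.Gamma (c + k)) * z ^ k) (Complex.regularizedGaussHGFun a b c z) := by
  have hz' : z ∈ Metric.eball (0 : ℂ) (Complex.regularizedGaussHGFunSeries a b c).radius := by
    refine Metric.eball_subset_eball (Complex.radius_regularizedGaussHGFunSeries_ge_one a b c) ?_
    rw [Metric.mem_eball, edist_zero_right, ← ofReal_norm, ← ENNReal.ofReal_one]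
    exact (ENNReal.ofReal_lt_ofReal_iff one_pos).2 hz
  have h := FormalMultilinearSeries.hasSum _ hz'
  rw [show (fun k : ℕ => Complex.regularizedGaussHGFunSeries a b c k fun _ => z) = _ from
    funext fun k => by
      rw [FormalMultilinearSeries.apply_eq_pow_smul_coeff,
        Complex.coeff_regularizedGaussHGFunSeries, smul_eq_mul, mul_comm]] at h
  exact h

/-- A contiguous relation that raises `b` and `c` and is not singular at `z = 1`. -/
theorem regularizedGaussHGFun_contiguous (a b c : ℂ) {z : ℂ} (hz : ‖z‖ < 1) :
    Complex.regularizedGaussHGFun a b c z =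
      (c - a) * Complex.regularizedGaussHGFun a (b + 1) (c + 1) z +
      a * (1 - z) * Complex.regularizedGaussHGFun (a + 1) (b + 1) (c + 1) z := by
  set f : ℕ → ℂ := fun k : ℕ => (ascPochhammer ℂ k).eval a * (ascPochhammer ℂ k).eval (b + 1) /
      (k ! * Complex.Gamma (c + 1 + k)) * z ^ k with hf
  set g : ℕ → ℂ := fun k : ℕ =>
      (ascPochhammer ℂ k).eval (a + 1) * (ascPochhammer ℂ k).eval (b + 1) /
      (k ! * Complex.Gamma (c + 1 + k)) * z ^ k with hg
  have h0 := hasSum_regularizedGaussHGFun a b c hz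
  have h1 : HasSum f _ := hasSum_regularizedGaussHGFun a (b + 1) (c + 1) hz
  have h2 : HasSum g _ := hasSum_regularizedGaussHGFun (a + 1) (b + 1) (c + 1) hz
  -- Multiplication by `z` shifts the series by one place, so the relation can be checked
  -- coefficientwise.
  have h3 : HasSum (fun k : ℕ => k.casesOn 0 (fun j => z * g j) : ℕ → ℂ)
      (z * Complex.regularizedGaussHGFun (a + 1) (b + 1) (c + 1) z) := by
    rw [← hasSum_nat_add_iff' 1]
    simpa using h2.mul_left z
  have h4 := ((h1.mul_left (c - a)).add (h2.mul_left a)).sub (h3.mul_left a)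
  have key : (fun k : ℕ => (ascPochhammer ℂ k).eval a * (ascPochhammer ℂ k).eval b /
      (k ! * Complex.Gamma (c + k)) * z ^ k) = fun k => (c - a) * f k + a * g k -
        a * (k.casesOn 0 (fun j => z * g j) : ℂ) := by
    funext k
    have hG := Complex.one_div_Gamma_eq_self_mul_one_div_Gamma_add_one (c + k)
    cases k with
    | zero =>
      simp only [Nat.cast_zero, add_zero] at hG
      change _ = _ - a * 0
      simp only [hf, hg, ascPochhammer_zero, Polynomial.eval_one, Nat.factorial_zero,
        Nat.cast_one, Nat.cast_zero, add_zero, pow_zero, div_eq_mul_inv, one_mul, mul_one,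
        mul_zero, sub_zero]
      rw [hG]; ring
    | succ k =>
      have e : c + 1 + (k : ℂ) = c + (k + 1 : ℕ) := by push_cast; ring
      have e' : c + 1 + ((k + 1 : ℕ) : ℂ) = c + (k + 1 : ℕ) + 1 := by push_cast; ring
      have l (x : ℂ) : (ascPochhammer ℂ (k + 1)).eval x =
          x * (ascPochhammer ℂ k).eval (x + 1) := by
        rw [ascPochhammer_succ_left]; simp
      have hk : ((k : ℂ) + 1) ≠ 0 := by exact_mod_cast k.succ_ne_zero
      have hk' : (k ! : ℂ) ≠ 0 := by exact_mod_cast k.factorial_ne_zero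
      simp only [hf, hg, e, e', ascPochhammer_succ_eval k (a + 1),
        ascPochhammer_succ_eval k (b + 1), l a, l b, div_eq_mul_inv, mul_inv]
      rw [hG]
      simp only [Nat.factorial_succ, Nat.cast_mul]
      push_cast
      field_simp
      ring
  rw [key] at h0
  rw [h0.unique h4]; ring

theorem hasSum_one_sub_cpow_neg (a : ℂ) {z : ℂ} (hz : ‖z‖ < 1) :
    HasSum (fun k : ℕ => (ascPochhammer ℂ k).eval a / k ! * z ^ k) ((1 - z) ^ (-a)) := by
  have h := (Complex.one_div_one_sub_cpow_hasFPowerSeriesOnBall_zero a).hasSum (y := z)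
    (by rw [Metric.mem_eball, edist_zero_right, ← ofReal_norm, ← ENNReal.ofReal_one]
        exact (ENNReal.ofReal_lt_ofReal_iff one_pos).2 hz)
  rw [zero_add, one_div, ← Complex.cpow_neg] at h
  have e (k : ℕ) : Ring.choose (a + k - 1) k = (ascPochhammer ℂ k).eval a / k ! := by
    have := Ring.factorial_nsmul_multichoose_eq_ascPochhammer a k
    rw [Polynomial.ascPochhammer_smeval_eq_eval, nsmul_eq_mul] at this
    rw [← this, mul_div_cancel_left₀ _ (by exact_mod_cast k.factorial_ne_zero)]
    rw [Ring.choose, show a + k - 1 - k + 1 = a by ring]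
  simpa only [FormalMultilinearSeries.ofScalars_apply_eq, e, smul_eq_mul] using h

theorem Gamma_add_nat (z : ℂ) (hz : 0 < z.re) (k : ℕ) :
    Complex.Gamma (z + k) = (ascPochhammer ℂ k).eval z * Complex.Gamma z := by
  rw [← Complex.Gamma_add_nat_div_Gamma_eq z, div_mul_cancel₀ _ (Complex.Gamma_ne_zero_of_re_pos hz)]
  rintro m rfl
  simp at hz
  linarith [Nat.cast_nonneg (α := ℝ) m]

/-- Euler's integral. -/
theorem Gamma_mul_Gamma_mul_regularizedGaussHGFun (A : ℂ) {a b : ℂ} (ha : 0 < a.re)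
    (hb : 0 < b.re) {x : ℝ} (hx0 : 0 ≤ x) (hx1 : x < 1) :
    Complex.Gamma a * Complex.Gamma b * Complex.regularizedGaussHGFun A b (a + b) x =
      ∫ s in (0 : ℝ)..1, (s : ℂ) ^ (b - 1) * (1 - s : ℂ) ^ (a - 1) *
        (1 - (x * s : ℝ) : ℂ) ^ (-A) := by
  have hxn : ‖(x : ℂ)‖ < 1 := by rwa [Complex.norm_real, Real.norm_of_nonneg hx0]
  have h1 := (hasSum_regularizedGaussHGFun A b (a + b) hxn).mul_left
    (Complex.Gamma a * Complex.Gamma b)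
  have hint := Complex.betaIntegral_convergent hb ha
  -- Expand `(1 - xs)^{-A}` in its binomial series and integrate termwise; each term is a Beta
  -- integral. The bound uses `xs ≤ x < 1`.
  have h2 := intervalIntegral.hasSum_integral_of_dominated_convergence (μ := volume)
    (a := 0) (b := 1)
    (F := fun (k : ℕ) (s : ℝ) => (s : ℂ) ^ (b - 1) * (1 - s : ℂ) ^ (a - 1) *
      ((ascPochhammer ℂ k).eval A / k ! * ((x * s : ℝ) : ℂ) ^ k))
    (f := fun s : ℝ => (s : ℂ) ^ (b - 1) * (1 - s : ℂ) ^ (a - 1) *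
        (1 - (x * s : ℝ) : ℂ) ^ (-A))
    (bound := fun k s => ‖(s : ℂ) ^ (b - 1) * (1 - s : ℂ) ^ (a - 1)‖ *
      ‖(ascPochhammer ℂ k).eval A / k ! * (x : ℂ) ^ k‖)
    ?_ ?_ ?_ ?_ ?_
  · refine h1.unique ?_
    refine (congrArg (HasSum · _) (funext fun k => ?_)).mpr h2
    have hbk : 0 < (b + k).re := by simp; positivity
    have hab : a + b + k = b + k + a := by ring
    have e : Complex.betaIntegral (b + k) a * ((ascPochhammer ℂ k).eval A / k ! * (x : ℂ) ^ k) =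
        ∫ s in (0 : ℝ)..1, (s : ℂ) ^ (b - 1) * (1 - s : ℂ) ^ (a - 1) *
          ((ascPochhammer ℂ k).eval A / k ! * ((x * s : ℝ) : ℂ) ^ k) := by
      rw [Complex.betaIntegral, ← intervalIntegral.integral_mul_const]
      refine intervalIntegral.integral_congr_ae (Filter.Eventually.of_forall fun s hs => ?_)
      rw [uIoc_of_le zero_le_one] at hs
      have hs0 : (s : ℂ) ≠ 0 := by exact_mod_cast hs.1.ne'
      rw [show b + k - 1 = b - 1 + k by ring, Complex.cpow_add _ _ hs0, Complex.cpow_natCast]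
      push_cast
      ring
    have hG := Complex.Gamma_mul_Gamma_eq_betaIntegral hbk ha
    have hne : Complex.Gamma (b + k + a) ≠ 0 :=
      Complex.Gamma_ne_zero_of_re_pos (by rw [Complex.add_re]; positivity)
    rw [← e, hab, ← mul_div_cancel_left₀ (Complex.betaIntegral _ _) hne, ← hG,
      Gamma_add_nat b hb k]
    field_simp
  · intro k
    exact hint.def'.aestronglyMeasurable.mul (Continuous.aestronglyMeasurable (by fun_prop))
  · intro k
    refine Filter.Eventually.of_forall fun s hs => ?_
    rw [uIoc_of_le zero_le_one] at hs
    rw [norm_mul, norm_mul _ (((x * s : ℝ) : ℂ) ^ k), norm_mul _ ((x : ℂ) ^ k), norm_pow, norm_pow]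
    gcongr
    rw [Complex.norm_real, Complex.norm_real, Real.norm_of_nonneg hx0,
      Real.norm_of_nonneg (mul_nonneg hx0 hs.1.le)]
    exact mul_le_of_le_one_right hx0 hs.2
  · refine Filter.Eventually.of_forall fun s hs => ?_
    exact (hasSum_one_sub_cpow_neg A hxn).summable.norm.mul_left _
  · simp_rw [tsum_mul_left]
    exact hint.norm.mul_const _
  · refine Filter.Eventually.of_forall fun s hs => ?_
    rw [uIoc_of_le zero_le_one] at hs
    refine (hasSum_one_sub_cpow_neg A ?_).mul_left _
    rw [Complex.norm_real, Real.norm_of_nonneg (mul_nonneg hx0 hs.1.le)]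
    exact (mul_le_of_le_one_right hx0 hs.2).trans_lt hx1

/-! ### Bounds near `x = 1` that are uniform in the parameters. -/

theorem norm_euler_integrand_le {a b : ℂ} (ha : 1 ≤ a.re) (hb : 1 / 2 ≤ b.re) (j : ℕ) {x s : ℝ}
    (hx0 : 0 ≤ x) (hx1 : x < 1) (hs0 : 0 < s) (hs1 : s < 1) :
    (1 - x) ^ j * ‖(s : ℂ) ^ (b - 1) * (1 - s : ℂ) ^ (a - 1) * (1 - (x * s : ℝ) : ℂ) ^ (-(a + j))‖ ≤
      ‖(s : ℂ) ^ ((1 / 2 : ℂ) - 1) * (1 - s : ℂ) ^ ((1 / 2 : ℂ) - 1)‖ * (1 - x) ^ (-(1 / 2) : ℝ) := by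
  have h1s : 0 < 1 - s := sub_pos.2 hs1
  have h1x : 0 < 1 - x := sub_pos.2 hx1
  have hxs : 0 < 1 - x * s := sub_pos.2 (by nlinarith)
  have hs : 1 - s ≤ 1 - x * s := by nlinarith
  have hx : 1 - x ≤ 1 - x * s := by nlinarith
  have e1 : (1 - s : ℂ) = ((1 - s : ℝ) : ℂ) := by push_cast; rfl
  have e2 : (1 - (x * s : ℝ) : ℂ) = ((1 - x * s : ℝ) : ℂ) := by push_cast; rfl
  rw [e1, e2, norm_mul, norm_mul, norm_mul, Complex.norm_cpow_eq_rpow_re_of_pos hs0,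
    Complex.norm_cpow_eq_rpow_re_of_pos h1s, Complex.norm_cpow_eq_rpow_re_of_pos hxs,
    Complex.norm_cpow_eq_rpow_re_of_pos hs0, Complex.norm_cpow_eq_rpow_re_of_pos h1s]
  have r1 : (b - 1).re = b.re - 1 := by simp
  have r2 : (a - 1).re = a.re - 1 := by simp
  -- As `1 - xs` dominates both `1 - s` and `1 - x`, its power is distributed: `-(Re a - 1)` cancels
  -- `(1-s)^{a-1}`, `-j` cancels `(1-x)^j`, and the remaining `-1` is shared equally. What is left
  -- is the integrand of `B(1/2, 1/2)`, free of `a`, `b` and `j`.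
  have r3 : (-(a + j)).re = -(a.re - 1) + (-(j : ℝ)) + (-(1 / 2)) + (-(1 / 2)) := by
    simp; ring
  have r4 : ((1 / 2 : ℂ) - 1).re = -(1 / 2) := by norm_num
  rw [r1, r2, r3, r4, Real.rpow_add hxs, Real.rpow_add hxs, Real.rpow_add hxs]
  have b1 : s ^ (b.re - 1) ≤ s ^ (-(1 / 2) : ℝ) :=
    Real.rpow_le_rpow_of_exponent_ge hs0 hs1.le (by linarith)
  have b2 : (1 - x * s) ^ (-(a.re - 1)) ≤ (1 - s) ^ (-(a.re - 1)) :=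
    Real.rpow_le_rpow_of_nonpos h1s hs (by linarith)
  have b3 : (1 - x * s) ^ (-(j : ℝ)) ≤ (1 - x) ^ (-(j : ℝ)) :=
    Real.rpow_le_rpow_of_nonpos h1x hx (by simp)
  have b4 : (1 - x * s) ^ (-(1 / 2) : ℝ) ≤ (1 - x) ^ (-(1 / 2) : ℝ) :=
    Real.rpow_le_rpow_of_nonpos h1x hx (by norm_num)
  have b5 : (1 - x * s) ^ (-(1 / 2) : ℝ) ≤ (1 - s) ^ (-(1 / 2) : ℝ) :=
    Real.rpow_le_rpow_of_nonpos h1s hs (by norm_num)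
  calc _ ≤ (1 - x) ^ j * (s ^ (-(1 / 2) : ℝ) * (1 - s) ^ (a.re - 1) *
        ((1 - s) ^ (-(a.re - 1)) * (1 - x) ^ (-(j : ℝ)) * (1 - x) ^ (-(1 / 2) : ℝ) *
          (1 - s) ^ (-(1 / 2) : ℝ))) := by gcongr
    _ = _ := by
      rw [Real.rpow_neg h1s.le (a.re - 1), Real.rpow_neg h1x.le (j : ℝ), Real.rpow_natCast]
      have := (Real.rpow_pos_of_pos h1s (a.re - 1)).ne'
      field_simp

/-- The function `(1 - x)^j Γ(a) Γ(b) / Γ(a + b) ₂F₁(a + j, b; a + b; x)`. -/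
noncomputable def betaHG (j : ℕ) (a b : ℂ) (x : ℝ) : ℂ :=
  (1 - x : ℂ) ^ j * (Complex.Gamma a * Complex.Gamma b *
    Complex.regularizedGaussHGFun (a + j) b (a + b) x)

theorem exists_norm_betaHG_le_of_re :
    ∃ K : ℝ, 0 ≤ K ∧ ∀ (j : ℕ) (a b : ℂ) (x : ℝ), 1 ≤ a.re → 1 / 2 ≤ b.re → 0 ≤ x → x < 1 →
      ‖betaHG j a b x‖ ≤ K * (1 - x) ^ (-(1 / 2) : ℝ) := by
  refine ⟨∫ s in (0 : ℝ)..1, ‖(s : ℂ) ^ ((1 / 2 : ℂ) - 1) * (1 - s : ℂ) ^ ((1 / 2 : ℂ) - 1)‖,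
    intervalIntegral.integral_nonneg zero_le_one fun _ _ => norm_nonneg _, ?_⟩
  intro j a b x ha hb hx0 hx1
  have hint : IntervalIntegrable (fun s : ℝ =>
      (s : ℂ) ^ ((1 / 2 : ℂ) - 1) * (1 - s : ℂ) ^ ((1 / 2 : ℂ) - 1)) volume 0 1 :=
    Complex.betaIntegral_convergent (by norm_num) (by norm_num)
  rw [betaHG, Gamma_mul_Gamma_mul_regularizedGaussHGFun _ (by linarith) (by linarith) hx0 hx1,
    ← intervalIntegral.integral_const_mul, ← intervalIntegral.integral_mul_const]
  refine intervalIntegral.norm_integral_le_of_norm_le zero_le_one ?_ (hint.norm.mul_const _)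
  filter_upwards [compl_mem_ae_iff.2 (measure_singleton (1 : ℝ))] with s hs hs'
  have := norm_euler_integrand_le ha hb j hx0 hx1 hs'.1 (lt_of_le_of_ne hs'.2 hs)
  have e : ‖(1 - x : ℂ) ^ j‖ = (1 - x) ^ j := by
    rw [norm_pow, ← Complex.ofReal_one, ← Complex.ofReal_sub, Complex.norm_real,
      Real.norm_of_nonneg (sub_pos.2 hx1).le]
  rwa [norm_mul, e]

/-- The contiguous relation preserves the shape `c = a + b`, and its factor `1 - x` is exactly what
the weight `(1-x)^j` needs when `j` increases. The denominators come from `Γ(b+1) = b Γ(b)`. -/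
theorem betaHG_recurrence (j : ℕ) (a : ℂ) {b : ℂ} (hb : b ≠ 0) {x : ℝ} (hx0 : 0 ≤ x)
    (hx1 : x < 1) :
    betaHG j a b x =
      (b - j) / b * betaHG j a (b + 1) x + (a + j) / b * betaHG (j + 1) a (b + 1) x := by
  have hxn : ‖(x : ℂ)‖ < 1 := by rwa [Complex.norm_real, Real.norm_of_nonneg hx0]
  rw [betaHG, betaHG, betaHG, regularizedGaussHGFun_contiguous _ _ _ hxn,
    Complex.Gamma_add_one b hb, Nat.cast_add_one, ← add_assoc, ← add_assoc]
  field_simp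
  ring

/-- Here `m` counts the steps that bring `Re b` up to `1/2`; `j` and `D` are quantified inside the
induction because a step may raise both. Although `a` and `b` are unbounded, the coefficients
`(b-j)/b` and `(a+j)/b` are not: `a - b` is bounded and `b` stays away from `0`. -/
theorem exists_norm_betaHG_le (m : ℕ) : ∀ (j : ℕ) (D : ℝ), 0 ≤ D →
    ∃ K : ℝ, 0 ≤ K ∧ ∀ (a b : ℂ) (x : ℝ), 1 ≤ a.re → 1 / 2 ≤ b.re + m →
      (∀ i : ℕ, 1 / 2 ≤ ‖b + i‖) → ‖a - b‖ ≤ D → 0 ≤ x → x < 1 →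
      ‖betaHG j a b x‖ ≤ K * (1 - x) ^ (-(1 / 2) : ℝ) := by
  induction m with
  | zero =>
    intro j D hD
    obtain ⟨K, hK, h⟩ := exists_norm_betaHG_le_of_re
    exact ⟨K, hK, fun a b x ha hb _ _ => h j a b x ha (by simpa using hb)⟩
  | succ m ih =>
    intro j D hD
    obtain ⟨K₁, hK₁, h₁⟩ := ih j (D + 1) (by positivity)
    obtain ⟨K₂, hK₂, h₂⟩ := ih (j + 1) (D + 1) (by positivity)
    refine ⟨(1 + 2 * j) * K₁ + (1 + 2 * (D + j)) * K₂, by positivity, ?_⟩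
    intro a b x ha hb hbi hab hx0 hx1
    have hb2 : 1 / 2 ≤ ‖b‖ := by simpa using hbi 0
    have hbpos : 0 < ‖b‖ := by linarith
    have hb0 : b ≠ 0 := norm_pos_iff.1 hbpos
    have c1 : 1 / 2 ≤ (b + 1).re + m := by
      push_cast at hb; simp only [Complex.add_re, Complex.one_re]; linarith
    have c2 : ∀ i : ℕ, 1 / 2 ≤ ‖b + 1 + i‖ := fun i => by
      have := hbi (i + 1)
      push_cast at this
      rwa [show b + 1 + (i : ℂ) = b + (i + 1) by ring]
    have c3 : ‖a - (b + 1)‖ ≤ D + 1 := by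
      rw [← sub_sub]
      exact (norm_sub_le _ _).trans (by simpa using hab)
    have q1 : ‖(b - j) / b‖ ≤ 1 + 2 * j := by
      rw [norm_div, div_le_iff₀ hbpos]
      refine (norm_sub_le _ _).trans ?_
      rw [Complex.norm_natCast]
      nlinarith [Nat.cast_nonneg (α := ℝ) j]
    have q2 : ‖(a + j) / b‖ ≤ 1 + 2 * (D + j) := by
      rw [norm_div, div_le_iff₀ hbpos]
      calc ‖a + j‖ = ‖b + (a - b) + j‖ := by congr 1; ring
        _ ≤ ‖b‖ + D + j := by
          refine (norm_add₃_le).trans ?_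
          rw [Complex.norm_natCast]
          gcongr
        _ ≤ _ := by nlinarith [Nat.cast_nonneg (α := ℝ) j]
    rw [betaHG_recurrence j a hb0 hx0 hx1]
    refine (norm_add_le _ _).trans ?_
    rw [norm_mul, norm_mul, add_mul, mul_assoc, mul_assoc]
    gcongr
    · exact h₁ a (b + 1) x ha c1 c2 c3 hx0 hx1
    · exact h₂ a (b + 1) x ha c1 c2 c3 hx0 hx1

/-! ### The radial function `b_l(a_t)`. -/

/-- `Γ(1+l) = l Γ(l)` cancels `l` and the `Γ(l)` of the `c`-function, and the powers of `2` leave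
`1/8`. At a zero of the `c`-function both sides vanish by the conventions for division and for
`Complex.Gamma`, so that case needs no exclusion. -/
theorem bRad_eq (n : ℤ) {l : ℂ} (hl : 0 < l.re) (t : ℝ) :
    bRad n l t = 1 / 8 * (Real.cosh t : ℂ) ^ (-(1 + l)) *
      betaHG 0 ((1 + l + (|n| : ℤ)) / 2) ((1 + l - (|n| : ℤ)) / 2) (Real.cosh t ^ 2)⁻¹ := by
  have hl0 : l ≠ 0 := by rintro rfl; simp at hl
  have hl1 : ∀ k : ℕ, 1 + l ≠ -k := fun k hk => by
    have := congrArg Complex.re hk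
    simp at this
    linarith [Nat.cast_nonneg (α := ℝ) k]
  have hG := Complex.Gamma_ne_zero_of_re_pos hl
  have hF := Complex.ordinaryHypergeometric_div_Gamma_eq (a := (1 + l) / 2 + ((|n| : ℤ) : ℂ) / 2)
    (b := (1 + l) / 2 - ((|n| : ℤ) : ℂ) / 2) (z := (((Real.cosh t ^ 2)⁻¹ : ℝ) : ℂ)) hl1
  have e2 : ((2 * Real.cosh t : ℝ) : ℂ) ^ (-(1 + l)) =
      (2 : ℂ) ^ (-(1 + l)) * (Real.cosh t : ℂ) ^ (-(1 + l)) := by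
    rw [Complex.ofReal_mul, Complex.mul_cpow_ofReal_nonneg zero_le_two (Real.cosh_pos t).le,
      Complex.ofReal_ofNat]
  have e3 : (2 : ℂ) ^ (-(1 + l)) = 1 / 4 * (2 : ℂ) ^ (1 + -l) := by
    rw [show -(1 + l) = 1 + -l - (2 : ℕ) by push_cast; ring, Complex.cpow_sub _ _ two_ne_zero,
      Complex.cpow_natCast]
    ring
  have h2 : (2 : ℂ) ^ (1 + -l) ≠ 0 := by simp [Complex.cpow_eq_zero_iff]
  rw [div_eq_iff (Complex.Gamma_ne_zero hl1)] at hF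
  rw [bRad, cFun, Phi, hF, betaHG, e2, e3, add_comm 1 l, Complex.Gamma_add_one l hl0]
  simp only [Nat.cast_zero, add_zero, pow_zero, one_mul, neg_neg, sub_neg_eq_add]
  rw [show (l + 1 - ((|n| : ℤ) : ℂ)) / 2 = (l + 1) / 2 - ((|n| : ℤ) : ℂ) / 2 by ring,
    show (l + 1 + ((|n| : ℤ) : ℂ)) / 2 = (l + 1) / 2 + ((|n| : ℤ) : ℂ) / 2 by ring,
    show (l + 1) / 2 + ((|n| : ℤ) : ℂ) / 2 + ((l + 1) / 2 - ((|n| : ℤ) : ℂ) / 2) = l + 1 by ring]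
  simp only [one_div, mul_inv, inv_div, div_eq_mul_inv (Complex.Gamma _ * Complex.Gamma _)]
  field_simp
  ring_nf

/-- Off the balls, `b_l` has a bound on `A⁺` that depends on `l` only through `Re l`. -/
theorem exists_norm_bRad_le (n : ℤ) :
    ∃ K : ℝ, 0 ≤ K ∧ ∀ (l : ℂ) (t : ℝ), 1 < l.re → l ∉ balls n → 0 < t →
      ‖bRad n l t‖ ≤ K * ((Real.cosh t ^ 2) ^ (-((1 + l.re) / 2)) *
        (1 - (Real.cosh t ^ 2)⁻¹) ^ (-(1 / 2) : ℝ)) := by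
  obtain ⟨K, hK, h⟩ := exists_norm_betaHG_le n.natAbs 0 n.natAbs (Nat.cast_nonneg _)
  refine ⟨1 / 8 * K, by positivity, ?_⟩
  intro l t hl hball ht
  have hN : ((|n| : ℤ) : ℂ) = (n.natAbs : ℂ) := by
    rw [Int.abs_eq_natAbs]; simp
  set N := n.natAbs with hNdef
  have hc := Real.cosh_pos t
  have hc1 : 1 < Real.cosh t := Real.one_lt_cosh.2 ht.ne'
  rw [bRad_eq n (by linarith), norm_mul, norm_mul, hN, Complex.norm_cpow_eq_rpow_re_of_pos hc,
    ← Real.rpow_natCast (Real.cosh t) 2, ← Real.rpow_mul hc.le, Real.rpow_natCast]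
  have e : ((2 : ℕ) : ℝ) * -((1 + l.re) / 2) = (-(1 + l)).re := by simp; ring
  rw [e]
  have hx : (Real.cosh t ^ 2)⁻¹ < 1 := inv_lt_one_of_one_lt₀ (by nlinarith)
  have key := h ((1 + l + N) / 2) ((1 + l - N) / 2) (Real.cosh t ^ 2)⁻¹ ?_ ?_ ?_ ?_ (by positivity)
    hx
  · calc _ ≤ ‖(1 / 8 : ℂ)‖ * Real.cosh t ^ (-(1 + l)).re *
        (K * (1 - (Real.cosh t ^ 2)⁻¹) ^ (-(1 / 2) : ℝ)) := by gcongr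
      _ = _ := by norm_num; ring
  · have : ((1 + l + N) / 2 : ℂ).re = (1 + l.re + N) / 2 := by simp
    rw [this]; linarith [Nat.cast_nonneg (α := ℝ) N]
  · have : ((1 + l - N) / 2 : ℂ).re = (1 + l.re - N) / 2 := by simp
    rw [this]; linarith [Nat.cast_nonneg (α := ℝ) N]
  -- `b + i` is half the difference between `l` and the centre `|n| - 2i - 1`, so the balls cover
  -- the indices `i ≤ ⌊|n|/2⌋`. For larger `i` the real part alone suffices.
  · intro i
    by_cases hi : i < N / 2 + 1
    · have : l ∉ Metric.ball (((|n| - 2 * (i : ℤ) - 1 : ℤ)) : ℂ) 1 := fun hmem =>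
        hball (mem_biUnion (Finset.mem_range.2 hi) hmem)
      rw [Metric.mem_ball, not_lt, Complex.dist_eq] at this
      have e : (1 + l - N) / 2 + i = (l - ((|n| - 2 * (i : ℤ) - 1 : ℤ) : ℂ)) / 2 := by
        push_cast [hN]; ring
      rw [e, norm_div, Complex.norm_ofNat]
      linarith
    · have hi' : N + 1 ≤ 2 * i := by omega
      have hi'' : (N : ℝ) + 1 ≤ 2 * i := by exact_mod_cast hi'
      refine le_trans ?_ (Complex.re_le_norm _)
      have : ((1 + l - N) / 2 + i : ℂ).re = (1 + l.re - N) / 2 + i := by simp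
      rw [this]; linarith
  · have : (1 + l + N) / 2 - (1 + l - N) / 2 = (N : ℂ) := by ring
    rw [this, Complex.norm_natCast]

/-! ### Polar coordinates in the plane. -/

/-- With `u = r²` one has `r dr = du / 2`, and the angle contributes `2π`. -/
theorem lintegral_comp_norm_sq_complex {f : ℝ → ℝ≥0∞} (hf : Measurable f) :
    ∫⁻ z : ℂ, f (‖z‖ ^ 2) = ENNReal.ofReal Real.pi * ∫⁻ u in Ioi 0, f u := by
  have h1 : (fun x : ℝ => x ^ 2) '' Ioi 0 = Ioi 0 := by
    ext y
    constructor
    · rintro ⟨x, hx, rfl⟩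
      exact pow_pos (mem_Ioi.1 hx) 2
    · exact fun hy => ⟨√y, Real.sqrt_pos.2 hy, Real.sq_sqrt (le_of_lt hy)⟩
  have h2 : ∫⁻ u in Ioi 0, f u = ∫⁻ x in Ioi (0 : ℝ), ENNReal.ofReal |2 * x| * f (x ^ 2) := by
    conv_lhs => rw [← h1]
    refine lintegral_image_eq_lintegral_abs_deriv_mul measurableSet_Ioi
      (fun x _ => by simpa using (hasDerivAt_pow 2 x).hasDerivWithinAt) ?_ f
    intro x hx y hy hxy
    exact (pow_left_inj₀ (le_of_lt hx) (le_of_lt hy) two_ne_zero).1 hxy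
  rw [h2, ← Complex.lintegral_comp_polarCoord_symm]
  have h3 : ∀ p ∈ polarCoord.target, ENNReal.ofReal p.1 • f (‖Complex.polarCoord.symm p‖ ^ 2) =
      ENNReal.ofReal p.1 * f (p.1 ^ 2) := fun p _ => by
    rw [Complex.norm_polarCoord_symm, sq_abs, smul_eq_mul]
  rw [setLIntegral_congr_fun polarCoord.open_target.measurableSet h3, polarCoord_target,
    Measure.volume_eq_prod, ← Measure.prod_restrict, lintegral_prod _ (by fun_prop)]
  simp only [lintegral_const, Measure.restrict_apply MeasurableSet.univ, univ_inter,
    Real.volume_Ioo]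
  rw [lintegral_mul_const _ (by fun_prop), mul_comm,
    show Real.pi - -Real.pi = Real.pi * 2 by ring, ENNReal.ofReal_mul Real.pi_pos.le, mul_assoc,
    ← lintegral_const_mul _ (by fun_prop)]
  congr 1
  refine setLIntegral_congr_fun measurableSet_Ioi fun x hx => ?_
  rw [abs_mul, abs_of_pos (mem_Ioi.1 hx), abs_two, ENNReal.ofReal_mul zero_le_two, mul_assoc]

/-! ### Haar measure of `SL(2, ℝ)` as an image of Lebesgue measure on matrices. -/

/-- The matrix with the given columns. -/
def ofCols (v : (Fin 2 → ℝ) × (Fin 2 → ℝ)) : Matrix (Fin 2) (Fin 2) ℝ :=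
  !![v.1 0, v.2 0; v.1 1, v.2 1]

def colDet (v : (Fin 2 → ℝ) × (Fin 2 → ℝ)) : ℝ := v.1 0 * v.2 1 - v.2 0 * v.1 1

theorem det_ofCols (v : (Fin 2 → ℝ) × (Fin 2 → ℝ)) : (ofCols v).det = colDet v := by
  rw [ofCols, Matrix.det_fin_two_of, colDet]

theorem continuous_colDet : Continuous colDet := by
  unfold colDet; fun_prop

def colAct (g : G) (v : (Fin 2 → ℝ) × (Fin 2 → ℝ)) : (Fin 2 → ℝ) × (Fin 2 → ℝ) :=
  (g.1.mulVec v.1, g.1.mulVec v.2)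

theorem ofCols_colAct (g : G) (v : (Fin 2 → ℝ) × (Fin 2 → ℝ)) :
    ofCols (colAct g v) = g.1 * ofCols v := by
  ext i j
  fin_cases i <;> fin_cases j <;>
    simp [ofCols, colAct, Matrix.mul_apply, Fin.sum_univ_two]

theorem colDet_colAct (g : G) (v : (Fin 2 → ℝ) × (Fin 2 → ℝ)) :
    colDet (colAct g v) = colDet v := by
  rw [← det_ofCols, ofCols_colAct, Matrix.det_mul, g.2, one_mul, det_ofCols]

theorem measurePreserving_colAct (g : G) : MeasurePreserving (colAct g) := by
  have h : MeasurePreserving (fun v : Fin 2 → ℝ => g.1.mulVec v) := by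
    refine ⟨by unfold Matrix.mulVec dotProduct; fun_prop, ?_⟩
    have := Real.map_matrix_volume_pi_eq_smul_volume_pi (M := g.1) (by rw [g.2]; exact one_ne_zero)
    rw [g.2, inv_one, abs_one, ENNReal.ofReal_one, one_smul] at this
    exact this
  exact h.prod h

/-- The multiple of determinant one of a matrix of positive determinant. -/
noncomputable def normalizeCols (v : (Fin 2 → ℝ) × (Fin 2 → ℝ)) (h : 0 < colDet v) : G :=
  ⟨(√(colDet v))⁻¹ • ofCols v, by
    rw [Matrix.det_smul, det_ofCols, Fintype.card_fin, inv_pow, Real.sq_sqrt h.le,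
      inv_mul_cancel₀ h.ne']⟩

/-- The projection of matrices of positive determinant to `G` along the scalars. -/
noncomputable def colProj (v : (Fin 2 → ℝ) × (Fin 2 → ℝ)) : G :=
  if h : 0 < colDet v then normalizeCols v h else 1

theorem coe_colProj {v : (Fin 2 → ℝ) × (Fin 2 → ℝ)} (h : 0 < colDet v) :
    (colProj v).1 = (√(colDet v))⁻¹ • ofCols v := by
  rw [colProj, dif_pos h, normalizeCols]

theorem colProj_colAct (g : G) {v : (Fin 2 → ℝ) × (Fin 2 → ℝ)} (h : 0 < colDet v) :
    colProj (colAct g v) = g * colProj v := by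
  apply Subtype.ext
  change _ = g.1 * (colProj v).1
  rw [coe_colProj h, coe_colProj (by rwa [colDet_colAct]), colDet_colAct, ofCols_colAct,
    Matrix.mul_smul]

/-- The matrices whose determinant lies in `(0, 1]`. -/
def cone : Set ((Fin 2 → ℝ) × (Fin 2 → ℝ)) := colDet ⁻¹' Ioc 0 1

theorem measurableSet_cone : MeasurableSet cone :=
  continuous_colDet.measurable measurableSet_Ioc

section Haar

variable [MeasurableSpace G] [BorelSpace G]

theorem measurable_colProj : Measurable colProj := by
  have hS : MeasurableSet {v | 0 < colDet v} :=
    (isOpen_lt continuous_const continuous_colDet).measurableSet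
  have h : ContinuousOn colProj {v | 0 < colDet v} := by
    rw [continuousOn_iff_continuous_domRestrict]
    refine continuous_induced_rng.2 ?_
    change Continuous fun v : {v | 0 < colDet v} => (colProj v.1).1
    rw [show (fun v : {v | 0 < colDet v} => (colProj v.1).1) =
      fun v => (√(colDet v.1))⁻¹ • ofCols v.1 from funext fun v => coe_colProj v.2]
    refine Continuous.smul (Continuous.inv₀ ?_ fun v => (Real.sqrt_pos.2 v.2).ne') ?_
    · exact (continuous_colDet.comp continuous_subtype_val).sqrt
    · refine Continuous.comp (g := ofCols) ?_ continuous_subtype_val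
      refine continuous_matrix fun i j => ?_
      fin_cases i <;> fin_cases j <;> simp [ofCols] <;> fun_prop
  classical
  have h' := h.measurable_piecewise (g := fun _ => (1 : G)) continuousOn_const hS
  convert h' using 1
  funext v
  by_cases hv : 0 < colDet v
  · simp [Set.piecewise, hv]
  · simp [Set.piecewise, hv, colProj]

/-- The image of Lebesgue measure on the matrices with determinant in `(0, 1]`. -/
noncomputable def coneMeasure : Measure G := (volume.restrict cone).map colProj

/-- Left multiplication by `g` preserves Lebesgue measure and the determinant, hence the cone, and
it commutes with the projection along scalars. -/
instance isMulLeftInvariant_coneMeasure : coneMeasure.IsMulLeftInvariant := by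
  refine ⟨fun g => ?_⟩
  have hg : Measurable (g * · : G → G) := (continuous_const_mul g).measurable
  have hpre : colAct g ⁻¹' cone = cone := by
    ext v; simp [cone, colDet_colAct]
  have hm := (measurePreserving_colAct g).restrict_preimage measurableSet_cone
  rw [hpre] at hm
  rw [coneMeasure, Measure.map_map hg measurable_colProj]
  conv_rhs => rw [← hm.map_eq, Measure.map_map measurable_colProj hm.measurable]
  refine Measure.map_congr ?_
  filter_upwards [ae_restrict_mem measurableSet_cone] with v hv
  exact (colProj_colAct g hv.1).symm

/-- A matrix `v` in the cone is `√det v ≤ 1` times its projection, so the preimage of a compact set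
within the cone is bounded. -/
instance isFiniteMeasureOnCompacts_coneMeasure : IsFiniteMeasureOnCompacts coneMeasure := by
  refine ⟨fun K hK => ?_⟩
  have hc (i j : Fin 2) : Continuous fun g : G => g.1 i j :=
    (continuous_apply_apply i j).comp continuous_subtype_val
  choose R hR using fun i j => hK.exists_bound_of_continuousOn (hc i j).continuousOn
  rw [coneMeasure, Measure.map_apply measurable_colProj hK.measurableSet,
    Measure.restrict_apply' measurableSet_cone]
  set M := ∑ i, ∑ j, |R i j| with hM
  have hRM (i j : Fin 2) : R i j ≤ M :=
    (le_abs_self _).trans <| (Finset.single_le_sum (f := fun j => |R i j|)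
      (fun _ _ => abs_nonneg _) (Finset.mem_univ j)).trans
      (Finset.single_le_sum (f := fun i => ∑ j, |R i j|)
        (fun _ _ => Finset.sum_nonneg fun _ _ => abs_nonneg _) (Finset.mem_univ i))
  refine (measure_mono fun v hv => ?_).trans_lt
    (measure_closedBall_lt_top (x := (0 : (Fin 2 → ℝ) × (Fin 2 → ℝ))) (r := M))
  obtain ⟨hvK, hv0, hv1⟩ := hv
  have hM0 : 0 ≤ M := Finset.sum_nonneg fun _ _ => Finset.sum_nonneg fun _ _ => abs_nonneg _
  have hb (i j : Fin 2) : ‖ofCols v i j‖ ≤ M := by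
    have h1 := (hR i j _ hvK).trans (hRM i j)
    rw [coe_colProj hv0, Matrix.smul_apply, norm_smul, norm_inv,
      Real.norm_of_nonneg (Real.sqrt_nonneg _), inv_mul_le_iff₀ (Real.sqrt_pos.2 hv0)] at h1
    refine h1.trans (mul_le_of_le_one_left hM0 ?_)
    rw [Real.sqrt_le_one]
    exact hv1
  rw [mem_closedBall_zero_iff, Prod.norm_def, max_le_iff, pi_norm_le_iff_of_nonneg hM0,
    pi_norm_le_iff_of_nonneg hM0]
  constructor <;> intro i <;> fin_cases i
  exacts [hb 0 0, hb 1 0, hb 0 1, hb 1 1]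

theorem coneMeasure_ne_zero : coneMeasure ≠ 0 := by
  have h : coneMeasure univ ≠ 0 := by
    rw [coneMeasure, Measure.map_apply measurable_colProj MeasurableSet.univ, preimage_univ,
      Measure.restrict_apply_univ]
    have ho : IsOpen (colDet ⁻¹' Ioo 0 1) := isOpen_Ioo.preimage continuous_colDet
    refine (lt_of_lt_of_le (ho.measure_pos volume ⟨(![1 / 2, 0], ![0, 1]), ?_⟩)
      (measure_mono (preimage_mono Ioo_subset_Ioc_self))).ne'
    norm_num [colDet]
  exact fun h0 => h (by rw [h0]; rfl)

instance locallyCompactSpace : LocallyCompactSpace G := by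
  have : LocallyCompactSpace (Matrix (Fin 2) (Fin 2) ℝ) :=
    inferInstanceAs (LocallyCompactSpace (Fin 2 → Fin 2 → ℝ))
  exact Matrix.SpecialLinearGroup.isClosedEmbedding_val.locallyCompactSpace

instance secondCountableTopology : SecondCountableTopology G := by
  have : SecondCountableTopology (Matrix (Fin 2) (Fin 2) ℝ) :=
    inferInstanceAs (SecondCountableTopology (Fin 2 → Fin 2 → ℝ))
  exact Topology.IsEmbedding.subtypeVal.secondCountableTopology

theorem exists_eq_smul_coneMeasure (μ : Measure G) [μ.IsHaarMeasure] :
    ∃ c : ℝ≥0∞, c ≠ ⊤ ∧ μ = c • coneMeasure := by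
  have h := Measure.isMulLeftInvariant_eq_smul coneMeasure μ
  set c := Measure.haarScalarFactor coneMeasure μ
  have hc : c ≠ 0 := fun h0 => coneMeasure_ne_zero (by rw [h, h0, zero_smul])
  refine ⟨((c⁻¹ : NNReal) : ℝ≥0∞), ENNReal.coe_ne_top, ?_⟩
  rw [h, ENNReal.smul_def, smul_smul, ← ENNReal.coe_mul, inv_mul_cancel₀ hc]
  simp

end Haar

/-! ### The radial part of Haar measure. -/

/-- The coordinates on the `2 × 2` matrices in which the determinant is `|z|^2 - |w|^2`. -/
noncomputable def cartEquiv : ((Fin 2 → ℝ) × (Fin 2 → ℝ)) ≃ₗ[ℝ] ℂ × ℂ where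
  toFun v := (⟨(v.1 0 + v.2 1) / 2, (v.2 0 - v.1 1) / 2⟩, ⟨(v.1 0 - v.2 1) / 2, (v.2 0 + v.1 1) / 2⟩)
  invFun p := (![p.1.re + p.2.re, p.2.im - p.1.im], ![p.1.im + p.2.im, p.1.re - p.2.re])
  map_add' v w := by
    refine Prod.ext (Complex.ext ?_ ?_) (Complex.ext ?_ ?_) <;> simp <;> ring
  map_smul' c v := by
    refine Prod.ext (Complex.ext ?_ ?_) (Complex.ext ?_ ?_) <;> simp <;> ring
  left_inv v := by
    ext i <;> fin_cases i <;> simp <;> ring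
  right_inv p := by
    refine Prod.ext (Complex.ext ?_ ?_) (Complex.ext ?_ ?_) <;> simp <;> ring

theorem colDet_eq (v : (Fin 2 → ℝ) × (Fin 2 → ℝ)) :
    colDet v = ‖(cartEquiv v).1‖ ^ 2 - ‖(cartEquiv v).2‖ ^ 2 := by
  rw [← Complex.normSq_eq_norm_sq, ← Complex.normSq_eq_norm_sq]
  simp only [cartEquiv, LinearEquiv.coe_mk, LinearMap.coe_mk, AddHom.coe_mk, Complex.normSq_apply,
    colDet]
  ring

theorem norm_cart_colProj {v : (Fin 2 → ℝ) × (Fin 2 → ℝ)} (h : 0 < colDet v) :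
    ‖cart (colProj v)‖ ^ 2 = ‖(cartEquiv v).1‖ ^ 2 / colDet v := by
  have e : cart (colProj v) = ((√(colDet v))⁻¹ : ℝ) * (cartEquiv v).1 := by
    rw [cart, coe_colProj h]
    apply Complex.ext <;> simp [cartEquiv, ofCols] <;> ring
  rw [e, norm_mul, Complex.norm_real, mul_pow, Real.norm_eq_abs, sq_abs, inv_pow,
    Real.sq_sqrt h.le, div_eq_inv_mul]

theorem exists_map_cartEquiv :
    ∃ c : ℝ≥0∞, c ≠ ⊤ ∧ (volume : Measure ((Fin 2 → ℝ) × (Fin 2 → ℝ))).map cartEquiv =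
      c • (volume : Measure (ℂ × ℂ)) := by
  have : (volume : Measure ((Fin 2 → ℝ) × (Fin 2 → ℝ))).IsAddHaarMeasure :=
    Measure.prod.instIsAddHaarMeasure _ _
  have : (volume : Measure (ℂ × ℂ)).IsAddHaarMeasure := Measure.prod.instIsAddHaarMeasure _ _
  have : ((volume : Measure ((Fin 2 → ℝ) × (Fin 2 → ℝ))).map
      cartEquiv.toContinuousLinearEquiv).IsAddHaarMeasure :=
    ContinuousLinearEquiv.isAddHaarMeasure_map _ _
  have h := Measure.isAddLeftInvariant_eq_smul ((volume : Measure ((Fin 2 → ℝ) ×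
    (Fin 2 → ℝ))).map cartEquiv.toContinuousLinearEquiv) (volume : Measure (ℂ × ℂ))
  exact ⟨_, ENNReal.coe_ne_top, h⟩

theorem lintegral_Ioi_comp_div {f : ℝ → ℝ≥0∞} {s : ℝ} (hs : 0 < s) :
    ∫⁻ w in Ioi 0, f ((w + s) / s) = ENNReal.ofReal s * ∫⁻ y in Ioi 1, f y := by
  have h1 : (fun y : ℝ => s * (y - 1)) '' Ioi 1 = Ioi 0 := by
    ext w
    constructor
    · rintro ⟨y, hy, rfl⟩
      exact mul_pos hs (sub_pos.2 hy)
    · intro hw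
      refine ⟨w / s + 1, by simpa using div_pos hw hs, ?_⟩
      field_simp
      ring
  rw [← h1, lintegral_image_eq_lintegral_abs_deriv_mul (f' := fun _ => s) measurableSet_Ioi
      (fun y _ => by
        simpa using (((hasDerivAt_id y).sub_const 1).const_mul s).hasDerivWithinAt)
      (fun x _ y _ hxy => by simpa [hs.ne'] using hxy), abs_of_pos hs,
    lintegral_const_mul' _ _ ENNReal.ofReal_ne_top]
  congr 1
  refine setLIntegral_congr_fun measurableSet_Ioi fun y _ => ?_
  congr 1
  field_simp
  ring

/-- With `u = |z|²`, `w = |w|²` and determinant `s = u - w`, pass from `(u, w)` to `(s, y)` with `y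
= u/s = (w+s)/s`. The Jacobian is `s`, so the two variables separate. -/
theorem lintegral_Ioi_prod_indicator {f : ℝ → ℝ≥0∞} (hf : Measurable f) :
    ∫⁻ w in Ioi (0 : ℝ), ∫⁻ u in Ioi (0 : ℝ),
        (Ioc (0 : ℝ) 1).indicator (fun s => f (u / s)) (u - w) =
      (∫⁻ s in Ioc (0 : ℝ) 1, ENNReal.ofReal s) * ∫⁻ y in Ioi 1, f y := by
  have h1 (w : ℝ) (hw : w ∈ Ioi (0 : ℝ)) : ∫⁻ u in Ioi (0 : ℝ),
      (Ioc (0 : ℝ) 1).indicator (fun s => f (u / s)) (u - w) =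
      ∫⁻ s in Ioc (0 : ℝ) 1, f ((w + s) / s) := by
    rw [← lintegral_indicator measurableSet_Ioi, ← lintegral_add_left_eq_self _ w,
      ← lintegral_indicator measurableSet_Ioc]
    refine lintegral_congr fun s => ?_
    have e : (Ioi (0 : ℝ)).indicator (fun u => (Ioc (0 : ℝ) 1).indicator (fun s => f (u / s))
        (u - w)) (w + s) = (Ioi (0 : ℝ)).indicator (fun u => (Ioc (0 : ℝ) 1).indicator
          (fun s => f (u / s)) s) (w + s) := by
      simp only [indicator, add_sub_cancel_left]
    rw [e]
    by_cases hs : s ∈ Ioc (0 : ℝ) 1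
    · rw [indicator_of_mem (show w + s ∈ Ioi (0 : ℝ) from add_pos hw hs.1),
        indicator_of_mem hs, indicator_of_mem hs]
    · rw [indicator_of_notMem hs]
      by_cases hws : w + s ∈ Ioi (0 : ℝ)
      · rw [indicator_of_mem hws, indicator_of_notMem hs]
      · rw [indicator_of_notMem hws]
  rw [setLIntegral_congr_fun measurableSet_Ioi h1, lintegral_lintegral_swap (by fun_prop),
    setLIntegral_congr_fun measurableSet_Ioc (fun s hs => lintegral_Ioi_comp_div hs.1),
    lintegral_mul_const _ (by fun_prop)]

theorem continuous_cart : Continuous cart := by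
  have hc (i j : Fin 2) : Continuous fun g : G => g.1 i j :=
    (continuous_apply_apply i j).comp continuous_subtype_val
  have : cart = fun g : G => (((g.1 0 0 + g.1 1 1) / 2 : ℝ) : ℂ) +
      (((g.1 0 1 - g.1 1 0) / 2 : ℝ) : ℂ) * Complex.I := by
    funext g
    exact (Complex.re_add_im (cart g)).symm
  rw [this]
  have := hc 0 0
  have := hc 0 1
  have := hc 1 0
  have := hc 1 1
  fun_prop

/-- The radial part of the Haar measure in the Cartan decomposition, in the coordinate
`‖cart g‖ ^ 2`, is Lebesgue measure on `(1, ∞)`. -/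
theorem exists_lintegral_comp_norm_cart [MeasurableSpace G] [BorelSpace G] (μ : Measure G)
    [μ.IsHaarMeasure] :
    ∃ C : ℝ≥0∞, C ≠ ⊤ ∧ ∀ f : ℝ → ℝ≥0∞, Measurable f →
      ∫⁻ g, f (‖cart g‖ ^ 2) ∂μ = C * ∫⁻ y in Ioi 1, f y := by
  obtain ⟨c, hc, hμ⟩ := exists_eq_smul_coneMeasure μ
  obtain ⟨d, hd, hmap⟩ := exists_map_cartEquiv
  have hcart := continuous_cart
  have hequiv : Measurable cartEquiv := cartEquiv.toContinuousLinearEquiv.continuous.measurable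
  refine ⟨c * (d * (ENNReal.ofReal Real.pi * (ENNReal.ofReal Real.pi *
    ∫⁻ s in Ioc (0 : ℝ) 1, ENNReal.ofReal s))), ?_, fun f hf => ?_⟩
  · have : ∫⁻ s in Ioc (0 : ℝ) 1, ENNReal.ofReal s ≠ ⊤ := by
      refine ((setLIntegral_mono measurable_const (g := fun _ => 1) fun s hs => ?_).trans_lt ?_).ne
      · simpa using hs.2
      · simp
    finiteness
  -- The integrand on the cone in the coordinates `(z, w)`. It depends only on `|z|²` and `|w|²`, so
  -- polar coordinates apply in each factor.
  set ψ : ℂ × ℂ → ℝ≥0∞ := fun p =>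
    (Ioc (0 : ℝ) 1).indicator (fun s => f (‖p.1‖ ^ 2 / s)) (‖p.1‖ ^ 2 - ‖p.2‖ ^ 2) with hψ
  have hφ : Measurable fun q : ℝ × ℝ =>
      (Ioc (0 : ℝ) 1).indicator (fun s => f (q.1 / s)) (q.1 - q.2) := by
    have : (fun q : ℝ × ℝ => (Ioc (0 : ℝ) 1).indicator (fun s => f (q.1 / s)) (q.1 - q.2)) =
        ((fun q : ℝ × ℝ => q.1 - q.2) ⁻¹' Ioc (0 : ℝ) 1).indicator
          (fun q => f (q.1 / (q.1 - q.2))) := rfl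
    rw [this]
    exact Measurable.indicator (by fun_prop)
      ((measurable_fst.sub measurable_snd) measurableSet_Ioc)
  have hψm : Measurable ψ :=
    hφ.comp (f := fun p : ℂ × ℂ => (‖p.1‖ ^ 2, ‖p.2‖ ^ 2)) (by fun_prop)
  have h1 : ∫⁻ g, f (‖cart g‖ ^ 2) ∂coneMeasure =
      ∫⁻ v : (Fin 2 → ℝ) × (Fin 2 → ℝ), ψ (cartEquiv v) := by
    rw [coneMeasure, lintegral_map (f := fun g => f (‖cart g‖ ^ 2)) (by fun_prop) measurable_colProj,
      ← lintegral_indicator measurableSet_cone]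
    refine lintegral_congr fun v => ?_
    simp only [hψ]
    rw [← colDet_eq]
    by_cases hv : v ∈ cone
    · rw [indicator_of_mem hv, indicator_of_mem (show colDet v ∈ Ioc (0 : ℝ) 1 from hv),
        norm_cart_colProj hv.1]
    · rw [indicator_of_notMem hv, indicator_of_notMem (show colDet v ∉ Ioc (0 : ℝ) 1 from hv)]
  rw [hμ, lintegral_smul_measure, h1, ← lintegral_map hψm hequiv, hmap, lintegral_smul_measure,
    Measure.volume_eq_prod, lintegral_prod_symm _ hψm.aemeasurable, smul_eq_mul, smul_eq_mul]
  simp only [mul_assoc]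
  congr 2
  have h2 (w : ℂ) : ∫⁻ z : ℂ, ψ (z, w) = ENNReal.ofReal Real.pi * ∫⁻ u in Ioi (0 : ℝ),
      (Ioc (0 : ℝ) 1).indicator (fun s => f (u / s)) (u - ‖w‖ ^ 2) :=
    lintegral_comp_norm_sq_complex (f := fun u =>
      (Ioc (0 : ℝ) 1).indicator (fun s => f (u / s)) (u - ‖w‖ ^ 2))
      (hφ.comp (f := fun u : ℝ => (u, ‖w‖ ^ 2)) (by fun_prop))
  simp only [h2]
  have h3 : Measurable fun w : ℝ => ∫⁻ u in Ioi (0 : ℝ),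
      (Ioc (0 : ℝ) 1).indicator (fun s => f (u / s)) (u - w) :=
    Measurable.lintegral_prod_left' hφ
  rw [lintegral_const_mul' _ _ ENNReal.ofReal_ne_top, lintegral_comp_norm_sq_complex
    (f := fun w : ℝ => ∫⁻ u in Ioi (0 : ℝ),
      (Ioc (0 : ℝ) 1).indicator (fun s => f (u / s)) (u - w)) h3,
    lintegral_Ioi_prod_indicator hf]

/-! ### Measurability, the majorant and the `L¹` norm. -/

theorem continuousOn_betaHG (j : ℕ) (a b : ℂ) : ContinuousOn (betaHG j a b) (Ico 0 1) := by
  have h : ContinuousOn (Complex.regularizedGaussHGFun (a + j) b (a + b)) (Metric.ball 0 1) := by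
    refine (FormalMultilinearSeries.continuousOn
      (p := Complex.regularizedGaussHGFunSeries (a + j) b (a + b))).mono ?_
    rw [← Metric.eball_ofReal, ENNReal.ofReal_one]
    exact Metric.eball_subset_eball (Complex.radius_regularizedGaussHGFunSeries_ge_one _ _ _)
  have h' : ContinuousOn (fun x : ℝ => Complex.regularizedGaussHGFun (a + j) b (a + b) x)
      (Ico 0 1) := by
    refine h.comp Complex.continuous_ofReal.continuousOn fun x hx => ?_
    rw [mem_ball_zero_iff, Complex.norm_real, Real.norm_of_nonneg hx.1]
    exact hx.2
  unfold betaHG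
  fun_prop

theorem continuousOn_bFun (n : ℤ) {l : ℂ} (hl : 0 < l.re) :
    ContinuousOn (bFun n l) {g | 1 < ‖cart g‖} := by
  have hpos : ∀ g ∈ {g | 1 < ‖cart g‖}, ‖cart g‖ ≠ 0 := fun g hg =>
    (zero_lt_one.trans hg.out).ne'
  have hn : Continuous fun g : G => ‖cart g‖ := continuous_cart.norm
  have h1 : ContinuousOn (fun g : G => (cart g / (‖cart g‖ : ℂ)) ^ n) {g | 1 < ‖cart g‖} := by
    refine ContinuousOn.zpow₀ (continuous_cart.continuousOn.div
      (Complex.continuous_ofReal.comp hn).continuousOn fun g hg => ?_) n fun g hg => Or.inl ?_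
    · exact Complex.ofReal_ne_zero.2 (hpos g hg)
    · have := hpos g hg
      exact div_ne_zero (norm_ne_zero_iff.1 this) (Complex.ofReal_ne_zero.2 this)
  have h2 : ContinuousOn (fun g : G => ((‖cart g‖ : ℝ) : ℂ) ^ (-(1 + l))) {g | 1 < ‖cart g‖} := by
    refine (Complex.continuous_ofReal.comp hn).continuousOn.cpow_const fun g hg => ?_
    rw [Function.comp_apply, Complex.ofReal_mem_slitPlane]
    exact zero_lt_one.trans hg.out
  have h3 : ContinuousOn (fun g : G => betaHG 0 ((1 + l + (|n| : ℤ)) / 2)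
      ((1 + l - (|n| : ℤ)) / 2) (‖cart g‖ ^ 2)⁻¹) {g | 1 < ‖cart g‖} := by
    refine (continuousOn_betaHG _ _ _).comp ((hn.pow 2).continuousOn.inv₀ fun g hg =>
      pow_ne_zero 2 (hpos g hg)) fun g hg => ⟨by positivity, inv_lt_one_of_one_lt₀ ?_⟩
    exact one_lt_pow₀ hg two_ne_zero
  refine (h1.mul ((continuousOn_const (c := (1 / 8 : ℂ))).mul h2 |>.mul h3)).congr fun g hg => ?_
  rw [bFun, bRad_eq n hl, Real.cosh_arcosh (le_of_lt hg)]
  rfl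

/-- The majorant of `b_l` on `A⁺` in the coordinate `y = cosh² t`. -/
noncomputable def majorant (q y : ℝ) : ℝ := y ^ (-q) * (1 - y⁻¹) ^ (-(1 / 2) : ℝ)

theorem measurable_majorant (q : ℝ) : Measurable (majorant q) := by
  unfold majorant; fun_prop

theorem exists_norm_bFun_le (n : ℤ) :
    ∃ K : ℝ, 0 ≤ K ∧ ∀ (l : ℂ) (g : G), 1 < l.re → l ∉ balls n → 1 < ‖cart g‖ →
      ‖bFun n l g‖ ≤ K * majorant ((1 + l.re) / 2) (‖cart g‖ ^ 2) := by
  obtain ⟨K, hK, h⟩ := exists_norm_bRad_le n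
  refine ⟨K, hK, fun l g hl hb hg => ?_⟩
  have h' := h l _ hl hb (Real.arcosh_pos hg)
  rw [Real.cosh_arcosh hg.le] at h'
  have h1 : ‖cart g / (‖cart g‖ : ℂ)‖ = 1 := by
    rw [norm_div, Complex.norm_real, norm_norm, div_self (zero_lt_one.trans hg).ne']
  rw [bFun, norm_mul, norm_zpow, h1, one_zpow, one_mul]
  exact h'

theorem majorant_antitone {q r y : ℝ} (h : q ≤ r) (hy : 1 < y) : majorant r y ≤ majorant q y := by
  have : y⁻¹ < 1 := inv_lt_one_of_one_lt₀ hy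
  exact mul_le_mul_of_nonneg_right (Real.rpow_le_rpow_of_exponent_le hy.le (by linarith))
    (Real.rpow_nonneg (by linarith) _)

theorem tendsto_majorant {y : ℝ} (hy : 1 < y) : Tendsto (fun q => majorant q y) atTop (𝓝 0) := by
  have h : Tendsto (fun q : ℝ => y ^ (-q)) atTop (𝓝 0) := by
    have := tendsto_rpow_atTop_of_base_lt_one y⁻¹ (by linarith [inv_pos.2 (zero_lt_one.trans hy)])
      (inv_lt_one_of_one_lt₀ hy)
    refine this.congr fun q => ?_
    rw [Real.inv_rpow (by linarith), Real.rpow_neg (by linarith)]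
  simpa [majorant] using h.mul_const ((1 - y⁻¹) ^ (-(1 / 2) : ℝ))

/-- For `y ≤ 2`, `y^{-q} ≤ 1` and `1 - 1/y ≥ (y-1)/2`; for `y > 2`, `1 - 1/y ≥ 1/2`. The singularity
at `y = 1` is thus separated from the decay in `q`. -/
theorem majorant_le {q y : ℝ} (hq : 0 ≤ q) (hy : 1 < y) :
    majorant q y ≤ (1 / 2 : ℝ) ^ (-(1 / 2) : ℝ) *
      (y ^ (-q) + (Ioc 1 2).indicator (fun y => (y - 1) ^ (-(1 / 2) : ℝ)) y) := by
  have hy0 : 0 < y := by linarith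
  have hyq : 0 ≤ y ^ (-q) := Real.rpow_nonneg hy0.le _
  have hyq1 : y ^ (-q) ≤ 1 := Real.rpow_le_one_of_one_le_of_nonpos hy.le (by linarith)
  by_cases h2 : y ≤ 2
  · rw [indicator_of_mem (show y ∈ Ioc 1 2 from ⟨hy, h2⟩)]
    have e : 1 / 2 * (y - 1) ≤ 1 - y⁻¹ := by
      rw [show 1 - y⁻¹ = y⁻¹ * (y - 1) by field_simp]
      refine mul_le_mul_of_nonneg_right ?_ (by linarith)
      rw [one_div]
      exact inv_anti₀ hy0 h2
    have e' := Real.rpow_le_rpow_of_nonpos (z := -(1 / 2)) (by linarith) e (by norm_num)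
    rw [Real.mul_rpow (by norm_num) (by linarith)] at e'
    have hp : (0 : ℝ) ≤ (1 / 2 : ℝ) ^ (-(1 / 2) : ℝ) := by positivity
    have hm : 0 ≤ (1 - y⁻¹) ^ (-(1 / 2) : ℝ) :=
      Real.rpow_nonneg (by linarith [inv_lt_one_of_one_lt₀ hy]) _
    calc majorant q y ≤ 1 * (1 - y⁻¹) ^ (-(1 / 2) : ℝ) := mul_le_mul_of_nonneg_right hyq1 hm
      _ ≤ _ := by rw [one_mul, mul_add]; nlinarith
  · rw [indicator_of_notMem (fun h => h2 h.2), add_zero, majorant, mul_comm]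
    refine mul_le_mul_of_nonneg_right ?_ hyq
    refine Real.rpow_le_rpow_of_nonpos (by norm_num) ?_ (by norm_num)
    have : y⁻¹ ≤ 2⁻¹ := inv_anti₀ two_pos (by linarith)
    linarith

theorem exists_lintegral_majorant_le :
    ∃ M : ℝ, 0 ≤ M ∧ ∀ q : ℝ, 1 < q →
      ∫⁻ y in Ioi 1, ENNReal.ofReal (majorant q y) ≤ ENNReal.ofReal (M * (1 / (q - 1) + 1)) := by
  have hint : IntegrableOn (fun y : ℝ => (y - 1) ^ (-(1 / 2) : ℝ)) (Ioc 1 2) := by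
    have := (intervalIntegral.intervalIntegrable_rpow' (a := 0) (b := 1) (r := -(1 / 2))
      (by norm_num)).comp_sub_right 1
    rw [intervalIntegrable_iff, zero_add, one_add_one_eq_two, uIoc_of_le one_le_two] at this
    exact this
  set I := ∫⁻ y in Ioc 1 2, ENNReal.ofReal ((y - 1) ^ (-(1 / 2) : ℝ))
  have hI : I ≠ ⊤ := hint.lintegral_lt_top.ne
  set p : ℝ := (1 / 2 : ℝ) ^ (-(1 / 2) : ℝ)
  have hp : 0 ≤ p := by positivity
  refine ⟨p * (1 + I.toReal), by positivity, fun q hq => ?_⟩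
  have hq1 : 0 < q - 1 := by linarith
  have h1 : ∫⁻ y in Ioi (1 : ℝ), ENNReal.ofReal (y ^ (-q)) = ENNReal.ofReal (1 / (q - 1)) := by
    rw [← ofReal_integral_eq_lintegral_ofReal
      (integrableOn_Ioi_rpow_of_lt (by linarith) one_pos), integral_Ioi_rpow_of_lt (by linarith)
      one_pos, Real.one_rpow]
    · congr 1
      rw [show -q + 1 = -(q - 1) by ring, neg_div_neg_eq]
    · filter_upwards [ae_restrict_mem measurableSet_Ioi] with y hy
      exact Real.rpow_nonneg (zero_le_one.trans (le_of_lt hy)) _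
  have h2 : ∫⁻ y in Ioi (1 : ℝ), (Ioc (1 : ℝ) 2).indicator
      (fun y => ENNReal.ofReal ((y - 1) ^ (-(1 / 2) : ℝ))) y ≤ I := by
    refine (setLIntegral_le_lintegral _ _).trans ?_
    rw [lintegral_indicator measurableSet_Ioc]
  calc ∫⁻ y in Ioi 1, ENNReal.ofReal (majorant q y)
      ≤ ∫⁻ y in Ioi (1 : ℝ), ENNReal.ofReal p * (ENNReal.ofReal (y ^ (-q)) +
          (Ioc (1 : ℝ) 2).indicator (fun y => ENNReal.ofReal ((y - 1) ^ (-(1 / 2) : ℝ))) y) := by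
        refine setLIntegral_mono' measurableSet_Ioi fun y hy => ?_
        have e : (Ioc (1 : ℝ) 2).indicator
            (fun y => ENNReal.ofReal ((y - 1) ^ (-(1 / 2) : ℝ))) y =
            ENNReal.ofReal ((Ioc (1 : ℝ) 2).indicator (fun y => (y - 1) ^ (-(1 / 2) : ℝ)) y) := by
          by_cases h : y ∈ Ioc (1 : ℝ) 2 <;> simp [indicator, h]
        rw [e]
        refine (ENNReal.ofReal_le_ofReal (majorant_le (by linarith) hy)).trans ?_
        rw [ENNReal.ofReal_mul hp]
        gcongr
        exact ENNReal.ofReal_add_le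
    _ ≤ ENNReal.ofReal p * (ENNReal.ofReal (1 / (q - 1)) + I) := by
        rw [lintegral_const_mul' _ _ ENNReal.ofReal_ne_top, lintegral_add_left (by fun_prop), h1]
        gcongr
    _ = ENNReal.ofReal (p * (1 / (q - 1) + I.toReal)) := by
        rw [ENNReal.ofReal_mul hp, ENNReal.ofReal_add (by positivity) ENNReal.toReal_nonneg,
          ENNReal.ofReal_toReal hI]
    _ ≤ _ := by
        refine ENNReal.ofReal_le_ofReal ?_
        rw [mul_assoc]
        refine mul_le_mul_of_nonneg_left ?_ hp
        have : 0 ≤ 1 / (q - 1) * I.toReal := by positivity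
        nlinarith

theorem exists_eLpNorm_bFun_le [MeasurableSpace G] [BorelSpace G] (μ : Measure G)
    [μ.IsHaarMeasure] (n : ℤ) :
    ∃ C : ℝ, 0 ≤ C ∧ ∀ l : ℂ, 1 < l.re → l ∉ balls n →
      AEStronglyMeasurable (bFun n l) μ ∧ eLpNorm (bFun n l) 1 μ ≤
        ENNReal.ofReal C * ∫⁻ y in Ioi 1, ENNReal.ofReal (majorant ((1 + l.re) / 2) y) := by
  obtain ⟨C, hC, hμ⟩ := exists_lintegral_comp_norm_cart μ
  obtain ⟨K, hK, hb⟩ := exists_norm_bFun_le n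
  have hU : MeasurableSet {g : G | 1 < ‖cart g‖} :=
    (isOpen_lt continuous_const continuous_cart.norm).measurableSet
  -- The complement is a null set: apply the radial formula to the indicator of `(-∞, 1]`, which
  -- vanishes on `(1, ∞)`.
  have hae : ∀ᵐ g ∂μ, g ∈ {g : G | 1 < ‖cart g‖} := by
    have h := hμ ((Iic 1).indicator 1) (measurable_one.indicator measurableSet_Iic)
    have h0 : ∫⁻ y in Ioi (1 : ℝ), (Iic (1 : ℝ)).indicator (1 : ℝ → ℝ≥0∞) y = 0 := by
      rw [setLIntegral_congr_fun (g := fun _ => 0) measurableSet_Ioi fun y hy => ?_,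
        lintegral_zero]
      exact indicator_of_notMem (notMem_Iic.2 hy) _
    rw [h0, mul_zero, lintegral_eq_zero_iff] at h
    · filter_upwards [h] with g hg
      by_contra hg1
      have h1 : ‖cart g‖ ^ 2 ∈ Iic (1 : ℝ) := pow_le_one₀ (norm_nonneg _) (not_lt.1 hg1)
      rw [indicator_of_mem h1] at hg
      exact one_ne_zero hg
    · exact (measurable_one.indicator measurableSet_Iic).comp
        (continuous_cart.norm.pow 2).measurable
  refine ⟨C.toReal * K, by positivity, fun l hl hball => ⟨?_, ?_⟩⟩
  · rw [← Measure.restrict_eq_self_of_ae_mem hae]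
    exact (continuousOn_bFun n (by linarith)).aestronglyMeasurable hU
  · rw [eLpNorm_one_eq_lintegral_enorm]
    calc ∫⁻ g, ‖bFun n l g‖ₑ ∂μ
        ≤ ∫⁻ g, ENNReal.ofReal (K * majorant ((1 + l.re) / 2) (‖cart g‖ ^ 2)) ∂μ := by
          refine lintegral_mono_ae ?_
          filter_upwards [hae] with g hg
          rw [← ofReal_norm]
          exact ENNReal.ofReal_le_ofReal (hb l g hl hball hg)
      _ = _ := by
          rw [hμ (fun y => ENNReal.ofReal (K * majorant ((1 + l.re) / 2) y))
            ((measurable_majorant _).const_mul K).ennreal_ofReal]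
          simp only [ENNReal.ofReal_mul hK]
          rw [lintegral_const_mul' _ _ ENNReal.ofReal_ne_top,
            ENNReal.ofReal_mul ENNReal.toReal_nonneg, ENNReal.ofReal_toReal hC, mul_assoc]

/-- All centres are real and at most `|n| - 1`. -/
theorem ofReal_notMem_balls {n : ℤ} {x : ℝ} (hx : (n.natAbs : ℝ) ≤ x) : (x : ℂ) ∉ balls n := by
  intro h
  obtain ⟨i, -, hi⟩ := mem_iUnion₂.1 h
  rw [Metric.mem_ball, Complex.dist_eq, ← Complex.ofReal_intCast, ← Complex.ofReal_sub,
    Complex.norm_real] at hi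
  have h1 := (le_abs_self _).trans_lt hi
  have h2 : ((|n| : ℤ) : ℝ) = n.natAbs := by rw [Int.abs_eq_natAbs]; simp
  push_cast at h1 h2
  rw [h2] at h1
  linarith [Nat.cast_nonneg (α := ℝ) i]

theorem tendsto_lintegral_majorant :
    Tendsto (fun x : ℝ => ∫⁻ y in Ioi 1, ENNReal.ofReal (majorant ((1 + x) / 2) y)) atTop
      (𝓝 0) := by
  obtain ⟨M, hM, hMq⟩ := exists_lintegral_majorant_le
  have h := tendsto_lintegral_filter_of_dominated_convergence (μ := volume.restrict (Ioi (1 : ℝ)))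
    (l := atTop) (F := fun (x : ℝ) y => ENNReal.ofReal (majorant ((1 + x) / 2) y))
    (f := fun _ => 0) (fun y => ENNReal.ofReal (majorant 2 y))
    (Eventually.of_forall fun x => (measurable_majorant _).ennreal_ofReal) ?_
    ((hMq 2 one_lt_two).trans_lt ENNReal.ofReal_lt_top).ne ?_
  · simpa using h
  -- `x ≥ 3` means `q = (1+x)/2 ≥ 2`, so the integrable majorant with exponent `2` dominates.
  · filter_upwards [eventually_ge_atTop 3] with x hx
    filter_upwards [ae_restrict_mem measurableSet_Ioi] with y hy
    exact ENNReal.ofReal_le_ofReal (majorant_antitone (by linarith) hy)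
  · filter_upwards [ae_restrict_mem measurableSet_Ioi] with y hy
    have hq : Tendsto (fun x : ℝ => (1 + x) / 2) atTop atTop :=
      (tendsto_atTop_add_const_left _ _ tendsto_id).atTop_div_const two_pos
    simpa using ENNReal.tendsto_ofReal ((tendsto_majorant hy).comp hq)

end SL2

theorem mainTheorem5 [MeasurableSpace SL2.G] [BorelSpace SL2.G]
    (μ : MeasureTheory.Measure SL2.G) [μ.IsHaarMeasure] (n : ℤ) :
    (∃ C : ℝ, 0 < C ∧ ∀ l : ℂ, 1 < l.re → l ∉ SL2.balls n →
      MeasureTheory.MemLp (SL2.bFun n l) 1 μ ∧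
      MeasureTheory.eLpNorm (SL2.bFun n l) 1 μ ≤
        ENNReal.ofReal (C * ((1 + ‖l‖) / (l.re - 1)))) ∧
    Filter.Tendsto (fun ξ : ℝ => MeasureTheory.eLpNorm (SL2.bFun n (ξ : ℂ)) 1 μ)
      Filter.atTop (nhds 0) := by
  obtain ⟨C, hC, h⟩ := SL2.exists_eLpNorm_bFun_le μ n
  obtain ⟨M, hM, hMq⟩ := SL2.exists_lintegral_majorant_le
  constructor
  -- With `r = (1+‖l‖)/(Re l - 1)`, the terms `1/(q-1) = 2/(Re l - 1)` and `1` are at most `2r` and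
  -- `r`, hence the `3`; the `+ 1` makes the constant positive.
  · refine ⟨C * (M * 3) + 1, by positivity, fun l hl hb => ?_⟩
    obtain ⟨hm, hle⟩ := h l hl hb
    have hl1 : 0 < l.re - 1 := by linarith
    have hln : l.re ≤ ‖l‖ := Complex.re_le_norm l
    have hbound : MeasureTheory.eLpNorm (SL2.bFun n l) 1 μ ≤
        ENNReal.ofReal ((C * (M * 3) + 1) * ((1 + ‖l‖) / (l.re - 1))) := by
      refine hle.trans ?_
      refine (mul_le_mul_right (hMq ((1 + l.re) / 2) (by linarith)) _).trans ?_
      rw [← ENNReal.ofReal_mul hC]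
      refine ENNReal.ofReal_le_ofReal ?_
      set r := (1 + ‖l‖) / (l.re - 1) with hr
      have hr0 : 0 ≤ r := by positivity
      have h1 : 1 / ((1 + l.re) / 2 - 1) ≤ 2 * r := by
        rw [show (1 + l.re) / 2 - 1 = (l.re - 1) / 2 by ring, one_div_div, hr, ← mul_div_assoc]
        gcongr
        linarith [norm_nonneg l]
      have h2 : 1 ≤ r := by rw [hr, le_div_iff₀ hl1]; linarith
      calc C * (M * (1 / ((1 + l.re) / 2 - 1) + 1)) ≤ C * (M * (2 * r + r)) := by gcongr
        _ ≤ _ := by nlinarith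
    exact ⟨⟨hm, hbound.trans_lt ENNReal.ofReal_lt_top⟩, hbound⟩
  · have hlim := ENNReal.Tendsto.const_mul (a := ENNReal.ofReal C) SL2.tendsto_lintegral_majorant
      (Or.inr ENNReal.ofReal_ne_top)
    rw [mul_zero] at hlim
    refine tendsto_of_tendsto_of_tendsto_of_le_of_le' tendsto_const_nhds hlim
      (Filter.Eventually.of_forall fun _ => zero_le) ?_
    filter_upwards [Filter.eventually_ge_atTop (n.natAbs : ℝ), Filter.eventually_gt_atTop 1]
      with x hx hx1
    exact (h x (by simpa using hx1) (SL2.ofReal_notMem_balls hx)).2
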